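/- **Setting.** For $n\ge 1$ let $S_n$ be the symmetric group on $\{1,\dots,n\}$, $s_i=(i,i+1)$, and $s_{j,i}=s_js_{j-1}\cdots s_i$ if $i\le j$, the empty word if $i>j$. Every element of $S_n$ is represented by exactly one word (its normal form) $s_{1,i_1}s_{2,i_2}\cdots s_{n-1,i_{n-1}}$ with $1\le i_j\le j+1$; elements $u\in S_n$ are identified with their normal forms, and $[w]$ is the normal form of the element of $S_n$ represented by a word $w$. A word in $s_1,\dots,s_{n-1}$ is reduced if no shorter word in these letters represents the same element of $S_n$. On integer polynomials in $x_1,x_2,\dots$ let $\partial_i f=(f-s_if)/(x_i-x_{i+1})$, where $s_i$ interchanges $x_i$ and $x_{i+1}$, and $\partial_u=\partial_{a_1}\cdots\partial_{a_p}$ for a word $u=s_{a_1}\cdots s_{a_p}$. Let $w_0^n=s_{1,1}s_{2,1}\cdots s_{n-1,1}$, and for $w\in S_n$ let $\mathfrak S_w=\partial_{[w^{-1}w_0^n]}(x_1^{n-1}x_2^{n-2}\cdots x_{n-1})$ be its Schubert polynomial. Put $X[1,k]=x_1\cdots x_k$ (so $X[1,0]=1$), and $P(a>b)=1$ if $a>b$,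 $P(a>b)=0$ otherwise. Let $u=s_{1,i_1}\cdots s_{n-1,i_{n-1}}\in S_n$, $n\ge 2$. For $1\le r\le n-1$ put $q^u_{r,0}=r$. For $l\ge1$, as long as the set $M^u_{r,l}=\{j : 1\le j<q^u_{r,l-1},\ i_j\le i_r-l\le j\}$ is nonempty, put $q^u_{r,l}=\max M^u_{r,l}$; if $l$ is the first index with $M^u_{r,l}=\emptyset$, put $m^u_r=l-1$. Write $m=m^u_{n-1}$ and $q_j=q^u_{n-1,j}$. Let $\overrightarrow{T}=(t_m,\dots,t_1,0)$ range over the integer vectors with $i_{n-1}-j\le t_j\le q_j+1$ for $1\le j\le m$. Consider the word obtained from $s_{1,i_1}\cdots s_{n-2,i_{n-2}}$ by deleting, for each $j\in\{1,\dots,m\}$, the letter $s_{t_j}$ from the factor $s_{q_j,i_{q_j}}$ (nothing is deleted if the letter does not occur in that factor). If this word is reduced, $u(\overrightarrow{T})\in S_{n-1}$ is its normal form; otherwise $u(\overrightarrow{T})$ is undefined. Put $$X^u_{\overrightarrow T}=X[1,i_{n-1}-m-1]\prod_{1\le j\le m}x_{1+q_j}^{P(t_j>q_j)} .$$ Iterating,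 if $v=u(\overrightarrow{T_{n-1}},\dots,\overrightarrow{T_{l+1}})\in S_{l+1}$ is defined, put $u(\overrightarrow{T_{n-1}},\dots,\overrightarrow{T_{l}})=v(\overrightarrow{T_l})$, where $\overrightarrow{T_l}$ ranges over the vectors belonging to $v$. **Theorem.** For any $u\in S_n$ $(n\ge 2)$, $$\partial_u\mathfrak S_{w_0^n}=\sum_{\overrightarrow{T_{n-1}},\dots,\overrightarrow{T_1}}X^{u}_{\overrightarrow{T_{n-1}}}\,X^{u(\overrightarrow{T_{n-1}})}_{\overrightarrow{T_{n-2}}}\cdots X^{u(\overrightarrow{T_{n-1}},\dots,\overrightarrow{T_2})}_{\overrightarrow{T_1}},$$ where the sum is over all $\overrightarrow{T_{n-1}},\dots,\overrightarrow{T_1}$ such that $u(\overrightarrow{T_{n-1}},\dots,\overrightarrow{T_l})$ is defined for every $1\le l\le n-1$. Moreover, for every $n\ge1$ and every $w\in S_n$, all coefficients of monomials in $\mathfrak S_w$ are nonnegative integers. -/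

import Mathlib

namespace SchubertQ

/-- The symmetric group `S_n`, realised as the group of those permutations of `ℕ` that fix every
number outside `{1, …, n}`; in this form `S_n ⊆ S_{n+1}`. -/
abbrev SymGroup (n : ℕ) : Subgroup (Equiv.Perm ℕ) :=
  fixingSubgroup (Equiv.Perm ℕ) (Set.Icc 1 n)ᶜ

/-- The adjacent transposition `s_i = (i, i+1)`. -/
def simple (i : ℕ) : Equiv.Perm ℕ := Equiv.swap i (i + 1)

/-- The permutation represented by the word `s_{a_1} s_{a_2} ⋯ s_{a_p}`, written as the list
`[a_1, …, a_p]`. -/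
def perm (w : List ℕ) : Equiv.Perm ℕ := (w.map simple).prod

/-- `w` is a word in the letters `s_1, …, s_{n-1}`. -/
def IsWord (n : ℕ) (w : List ℕ) : Prop := ∀ a ∈ w, 1 ≤ a ∧ a < n

/-- `w` is a reduced word of `S_n`: no word in `s_1, …, s_{n-1}` representing the same element is
shorter. -/
def IsReduced (n : ℕ) (w : List ℕ) : Prop :=
  IsWord n w ∧ ∀ v, IsWord n v → perm v = perm w → w.length ≤ v.length

/-- The word `s_{j,i} = s_j s_{j-1} ⋯ s_i`, which is empty if `j < i`. -/
def descWord (j i : ℕ) : List ℕ := (List.range' i (j + 1 - i)).reverse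

/-- The set of normal forms `s_{1,i_1} s_{2,i_2} ⋯ s_{n-1,i_{n-1}}`, `1 ≤ i_j ≤ j + 1`, of `S_n`.
The irrelevant indices `i_j` with `n ≤ j` are normalised to `j + 1` (and `i_0 = 1` is forced), so
that `s_{j,i_j}` is empty there. -/
@[ext]
structure NormalForm (n : ℕ) where
  i : ℕ → ℕ
  one_le : ∀ j, 1 ≤ i j
  le : ∀ j, i j ≤ j + 1
  eq_of_ge : ∀ j, n ≤ j → i j = j + 1

/-- The word `s_{1,i_1} s_{2,i_2} ⋯ s_{n-1,i_{n-1}}`. -/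
def NormalForm.word {n : ℕ} (u : NormalForm n) : List ℕ :=
  (List.range' 1 (n - 1)).flatMap fun j => descWord j (u.i j)

theorem mem_descWord {a j i : ℕ} : a ∈ descWord j i ↔ i ≤ a ∧ a ≤ j := by
  simp only [descWord, List.mem_reverse, List.mem_range'_1]
  omega

theorem perm_append (v w : List ℕ) : perm (v ++ w) = perm v * perm w := by
  simp [perm]

theorem simple_mem {n i : ℕ} (h1 : 1 ≤ i) (h2 : i < n) : simple i ∈ SymGroup n := by
  rw [mem_fixingSubgroup_iff]
  intro y hy
  simp only [Set.mem_compl_iff, Set.mem_Icc] at hy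
  exact Equiv.swap_apply_of_ne_of_ne (by omega) (by omega)

theorem perm_mem {n : ℕ} {w : List ℕ} (h : IsWord n w) : perm w ∈ SymGroup n := by
  apply Subgroup.list_prod_mem
  intro x hx
  obtain ⟨a, ha, rfl⟩ := List.mem_map.1 hx
  exact simple_mem (h a ha).1 (h a ha).2

theorem NormalForm.isWord {n : ℕ} (u : NormalForm n) : IsWord n u.word := by
  intro a ha
  obtain ⟨j, hj, ha⟩ := List.mem_flatMap.1 ha
  rw [mem_descWord] at ha
  rw [List.mem_range'_1] at hj
  have := u.one_le j
  omega

theorem perm_descWord_apply {n i : ℕ} (h : i ≤ n + 1) : perm (descWord n i) i = n + 1 := by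
  induction n with
  | zero =>
    interval_cases i <;> simp [descWord, perm, simple]
  | succ n ih =>
    rcases Nat.lt_or_ge (n + 1) i with h' | h'
    · obtain rfl : i = n + 2 := by omega
      simp [descWord, perm]
    · have e : descWord (n + 1) i = (n + 1) :: descWord n i := by
        have : n + 1 + 1 - i = (n + 1 - i) + 1 := by omega
        simp only [descWord, this, List.range'_concat, List.reverse_append]
        simp only [one_mul, List.reverse_cons, List.reverse_nil, List.nil_append,
          List.singleton_append, List.cons.injEq, and_true]
        omega
      rw [e]
      simp only [perm, List.map_cons, List.prod_cons, Equiv.Perm.mul_apply]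
      have := ih h'
      rw [perm] at this
      rw [this, simple, Equiv.swap_apply_left]

/-- Omit the last factor of a normal form. -/
def NormalForm.init {n : ℕ} (u : NormalForm (n + 1)) : NormalForm n where
  i j := if j < n then u.i j else j + 1
  one_le j := by have := u.one_le j; split <;> omega
  le j := by have := u.le j; split <;> omega
  eq_of_ge j h := if_neg (by omega)

/-- Append a last factor `s_{n,a}` to a normal form. -/
def NormalForm.snoc {n : ℕ} (u : NormalForm n) (a : ℕ) (h1 : 1 ≤ a) (h2 : a ≤ n + 1) :
    NormalForm (n + 1) where
  i j := if j = n then a else u.i j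
  one_le j := by have := u.one_le j; split <;> omega
  le j := by have := u.le j; split <;> omega
  eq_of_ge j h := by rw [if_neg (by omega)]; exact u.eq_of_ge j (by omega)

theorem NormalForm.word_succ {n : ℕ} (hn : 1 ≤ n) (u : NormalForm (n + 1)) :
    u.word = u.init.word ++ descWord n (u.i n) := by
  obtain ⟨k, rfl⟩ : ∃ k, n = k + 1 := ⟨n - 1, by omega⟩
  have e : 1 + k = k + 1 := by omega
  simp only [word, Nat.add_sub_cancel, List.range'_concat, List.flatMap_append, one_mul,
    List.flatMap_cons, List.flatMap_nil, List.append_nil, e]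
  congr 1
  apply List.flatMap_congr
  intro j hj
  rw [List.mem_range'_1] at hj
  simp only [init, if_pos (show j < k + 1 by omega)]

/-- The normal forms represent every element of `S_n` exactly once. -/
theorem existsUnique_normalForm (n : ℕ) (hn : 1 ≤ n) (g : Equiv.Perm ℕ) (hg : g ∈ SymGroup n) :
    ∃! u : NormalForm n, perm u.word = g := by
  induction n, hn using Nat.le_induction generalizing g with
  | base =>
    have hg1 : g = 1 := by
      rw [mem_fixingSubgroup_iff] at hg
      have key : ∀ y, y ≠ 1 → g y = y := fun y hy => hg y (by simp; omega)
      ext y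
      rcases eq_or_ne y 1 with rfl | hy
      · by_contra hne
        have h2 := key (g 1) hne
        exact hne (g.injective h2)
      · simpa using key y hy
    refine ⟨⟨fun j => j + 1, by simp, by simp, by simp⟩, ?_, ?_⟩
    · simp [NormalForm.word, perm, hg1]
    · intro v _
      ext j
      rcases Nat.eq_zero_or_pos j with rfl | hj
      · exact le_antisymm (v.le 0) (v.one_le 0)
      · exact v.eq_of_ge j hj
  | succ n hn ih =>
    have hfix : ∀ y, ¬ (1 ≤ y ∧ y ≤ n + 1) → g y = y := by
      rw [mem_fixingSubgroup_iff] at hg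
      exact fun y hy => hg y (by simpa using hy)
    have fixn : ∀ v : NormalForm n, perm v.word (n + 1) = n + 1 := by
      intro v
      have := perm_mem v.isWord
      rw [mem_fixingSubgroup_iff] at this
      exact this (n + 1) (by simp)
    obtain ⟨a, ha⟩ := g.surjective (n + 1)
    have ha' : 1 ≤ a ∧ a ≤ n + 1 := by
      by_contra hc
      have := hfix a hc
      omega
    have hd : perm (descWord n a) ∈ SymGroup (n + 1) := by
      apply perm_mem
      intro b hb
      rw [mem_descWord] at hb
      omega
    have hg' : g * (perm (descWord n a))⁻¹ ∈ SymGroup n := by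
      have hm := (SymGroup (n + 1)).mul_mem hg ((SymGroup (n + 1)).inv_mem hd)
      rw [mem_fixingSubgroup_iff] at hm ⊢
      intro y hy
      rcases eq_or_ne y (n + 1) with rfl | hy'
      · have h3 := perm_descWord_apply (n := n) ha'.2
        have h4 : (perm (descWord n a))⁻¹ (n + 1) = a := by
          rw [Equiv.Perm.inv_eq_iff_eq, h3]
        rw [Equiv.Perm.smul_def, Equiv.Perm.mul_apply, h4, ha]
      · apply hm y
        simp only [Set.mem_compl_iff, Set.mem_Icc] at hy ⊢
        omega
    obtain ⟨v, hv, huniq⟩ := ih _ hg'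
    refine ⟨v.snoc a ha'.1 ha'.2, ?_, ?_⟩
    · have hinit : (v.snoc a ha'.1 ha'.2).init = v := by
        ext j
        simp only [NormalForm.init, NormalForm.snoc]
        split_ifs with h1 h2
        · omega
        · rfl
        · exact (v.eq_of_ge j (by omega)).symm
      simp only [NormalForm.word_succ hn, perm_append, hinit, hv]
      simp [NormalForm.snoc]
    · intro w hw
      have hw' := hw
      simp only [NormalForm.word_succ hn, perm_append] at hw'
      have hwa : w.i n = a := by
        apply g.injective
        rw [ha, ← hw', Equiv.Perm.mul_apply, perm_descWord_apply (w.le n), fixn]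
      have hwi : w.init = v := by
        apply huniq
        rw [← hw', hwa, mul_inv_cancel_right]
      ext j
      simp only [NormalForm.snoc, ← hwi, NormalForm.init]
      split_ifs with h1 h2
      · rw [h1, hwa]
      · rfl
      · exact w.eq_of_ge j (by omega)

/-- The normal form of an element of `S_n`: the unique normal form that represents it. -/
noncomputable def normalForm (n : ℕ) (hn : 1 ≤ n) (g : Equiv.Perm ℕ) (hg : g ∈ SymGroup n) :
    NormalForm n :=
  (existsUnique_normalForm n hn g hg).choose

open MvPolynomial

theorem X_sub_X_dvd (i : ℕ) (f : MvPolynomial ℕ ℤ) :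
    (X i - X (i + 1) : MvPolynomial ℕ ℤ) ∣ f - rename (Equiv.swap i (i + 1)) f := by
  induction f using MvPolynomial.induction_on with
  | C a => simp
  | add p q hp hq =>
    rw [map_add, add_sub_add_comm]
    exact dvd_add hp hq
  | mul_X p k hp =>
    have hk : (X i - X (i + 1) : MvPolynomial ℕ ℤ) ∣ X k - X (Equiv.swap i (i + 1) k) := by
      rcases eq_or_ne k i with rfl | h1
      · simp
      · rcases eq_or_ne k (i + 1) with rfl | h2
        · rw [Equiv.swap_apply_right, ← neg_sub (X (i + 1)), neg_dvd]
        · simp [Equiv.swap_apply_of_ne_of_ne h1 h2]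
    have e : p * X k - rename (Equiv.swap i (i + 1)) (p * X k) =
        (p - rename (Equiv.swap i (i + 1)) p) * X k +
          rename (Equiv.swap i (i + 1)) p * (X k - X (Equiv.swap i (i + 1) k)) := by
      rw [map_mul, rename_X]
      ring
    rw [e]
    exact dvd_add (hp.mul_right _) (hk.mul_left _)

/-- The divided difference `∂_i f = (f - s_i f) / (x_i - x_{i+1})`, where `s_i f` arises from `f`
by interchanging `x_i` and `x_{i+1}`. The variable `x_k` is `X k`; `x_0` is not used. -/
noncomputable def dd (i : ℕ) (f : MvPolynomial ℕ ℤ) : MvPolynomial ℕ ℤ :=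
  (X_sub_X_dvd i f).choose

/-- `∂_w = ∂_{a_1} ∂_{a_2} ⋯ ∂_{a_p}` for the word `w = s_{a_1} s_{a_2} ⋯ s_{a_p}`. -/
noncomputable def ddWord (w : List ℕ) (f : MvPolynomial ℕ ℤ) : MvPolynomial ℕ ℤ :=
  w.foldr dd f

/-- The normal form `w_0^n = s_{1,1} s_{2,1} ⋯ s_{n-1,1}`. -/
def w0 (n : ℕ) : NormalForm n where
  i j := if j < n then 1 else j + 1
  one_le j := by split <;> omega
  le j := by split <;> omega
  eq_of_ge j h := if_neg (by omega)

theorem w0_mem (n : ℕ) : perm (w0 n).word ∈ SymGroup n := perm_mem (w0 n).isWord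

/-- The Schubert polynomial `𝔖_w = ∂_{[w⁻¹ w_0^n]} (x_1^{n-1} x_2^{n-2} ⋯ x_{n-1})` of
`w ∈ S_n`. -/
noncomputable def schubert (n : ℕ) (hn : 1 ≤ n) (w : Equiv.Perm ℕ) (hw : w ∈ SymGroup n) :
    MvPolynomial ℕ ℤ :=
  ddWord (normalForm n hn (w⁻¹ * perm (w0 n).word)
      (mul_mem (inv_mem hw) (w0_mem n))).word
    (∏ k ∈ Finset.Icc 1 (n - 1), X k ^ (n - k))

namespace NormalForm

variable {n : ℕ}

/-- For `q = q_{r,l-1}` (with `l ≥ 1`), the set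
`M_{r,l} = {j | 1 ≤ j < q, i_r - l ∈ [i_j, j]}`. -/
def M (u : NormalForm n) (r l q : ℕ) : Finset ℕ :=
  {j ∈ Finset.Ico 1 q | u.i j + l ≤ u.i r ∧ u.i r ≤ j + l}

/-- The numbers `q_{r,0} = r` and `q_{r,l} = max M_{r,l}` (if `M_{r,l}` is empty, the value is the
irrelevant number `0`). -/
def q (u : NormalForm n) (r : ℕ) : ℕ → ℕ
  | 0 => r
  | l + 1 => (u.M r (l + 1) (u.q r l)).sup id

theorem exists_M_eq_empty (u : NormalForm n) (r : ℕ) :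
    ∃ l, u.M r (l + 1) (u.q r l) = ∅ := by
  by_contra! h
  have key : ∀ l, u.q r l + l ≤ r := by
    intro l
    induction l with
    | zero => simp [q]
    | succ l ih =>
      have hlt : u.q r (l + 1) < u.q r l := by
        obtain ⟨j, hj, e⟩ := Finset.exists_mem_eq_sup _ (h l) id
        rw [q, e]
        simp only [M, Finset.mem_filter, Finset.mem_Ico] at hj
        exact hj.1.2
      omega
  obtain ⟨j, hj⟩ := h r
  have := key r
  simp only [M, Finset.mem_filter, Finset.mem_Ico] at hj
  omega

/-- The number `m_r`: the least `l` for which `M_{r,l+1}` is empty. -/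
def m (u : NormalForm n) (r : ℕ) : ℕ := Nat.find (u.exists_M_eq_empty r)

/-- The vectors `(t_m, …, t_1)`, `m = m_{n-1}`, with `i_{n-1} - j ≤ t_j ≤ q_{n-1,j} + 1` for
`1 ≤ j ≤ m`. The element `j : Fin m` stands for the index `j + 1`. -/
abbrev Box (u : NormalForm n) : Type :=
  (j : Fin (u.m (n - 1))) →
    Finset.Icc (u.i (n - 1) - ((j : ℕ) + 1)) (u.q (n - 1) ((j : ℕ) + 1) + 1)

/-- The word that arises from `s_{1,i_1} s_{2,i_2} ⋯ s_{n-2,i_{n-2}}` when, for every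
`1 ≤ j ≤ m_{n-1}`, the letter `s_{t_j}` is omitted from the factor `s_{q,i_q}`, `q = q_{n-1,j}`
(which stays as it is if it does not contain this letter). -/
def deleteWord (u : NormalForm n) (T : u.Box) : List ℕ :=
  (List.range' 1 (n - 2)).flatMap fun k =>
    (descWord k (u.i k)).filter fun a =>
      ¬ ∃ j : Fin (u.m (n - 1)), u.q (n - 1) ((j : ℕ) + 1) = k ∧ (T j : ℕ) = a

theorem isWord_deleteWord (u : NormalForm n) (T : u.Box) :
    IsWord (n - 1) (u.deleteWord T) := by
  intro a ha
  obtain ⟨k, hk, ha⟩ := List.mem_flatMap.1 ha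
  have ha := mem_descWord.1 (List.mem_filter.1 ha).1
  rw [List.mem_range'_1] at hk
  have := u.one_le k
  omega

/-- The vectors `T` for which `u(T)` is defined, that is, for which the word obtained by deletion
is reduced. -/
abbrev DefBox (u : NormalForm n) : Type := {T : u.Box // IsReduced (n - 1) (u.deleteWord T)}

noncomputable instance (u : NormalForm n) : Fintype u.DefBox := by
  classical exact inferInstance

/-- `u(T) ∈ S_{n-1}`, the normal form of the word obtained by deletion, for `u ∈ S_n`. -/
noncomputable def step (u : NormalForm (n + 2)) (T : u.DefBox) : NormalForm (n + 1) :=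
  normalForm (n + 1) (Nat.le_add_left 1 n) (perm (u.deleteWord T.1))
    (perm_mem (u.isWord_deleteWord T.1))

/-- The monomial `X_T = X[1, i_{n-1} - m_{n-1} - 1] ∏_j x_{1 + q_{n-1,j}} ^ P(t_j > q_{n-1,j})`,
where `X[1, k] = x_1 x_2 ⋯ x_k`. -/
noncomputable def monomialX (u : NormalForm n) (T : u.Box) : MvPolynomial ℕ ℤ :=
  (∏ k ∈ Finset.Icc 1 (u.i (n - 1) - u.m (n - 1) - 1), X k) *
    ∏ j : Fin (u.m (n - 1)),
      X (1 + u.q (n - 1) ((j : ℕ) + 1)) ^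
        (if (T j : ℕ) > u.q (n - 1) ((j : ℕ) + 1) then 1 else 0)

/-- The chains `(T_{n-1}, …, T_1)` for which `u(T_{n-1}, …, T_l)` is defined for all
`1 ≤ l ≤ n - 1`: a choice of `T_{n-1}` with `u(T_{n-1})` defined, followed by such a chain for
`u(T_{n-1}) ∈ S_{n-1}`. -/
def Chain : (n : ℕ) → NormalForm n → Type
  | 0, _ => Unit
  | 1, _ => Unit
  | n + 2, u => Σ T : u.DefBox, Chain (n + 1) (u.step T)

@[reducible]
noncomputable def fintypeChain : (n : ℕ) → (u : NormalForm n) → Fintype (Chain n u)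
  | 0, _ => inferInstanceAs (Fintype Unit)
  | 1, _ => inferInstanceAs (Fintype Unit)
  | n + 2, u =>
    letI := fun T : u.DefBox => fintypeChain (n + 1) (u.step T)
    inferInstanceAs (Fintype (Σ T : u.DefBox, Chain (n + 1) (u.step T)))

noncomputable instance (u : NormalForm n) : Fintype (Chain n u) := fintypeChain n u

/-- The product `X_{T_{n-1}}^u X_{T_{n-2}}^{u(T_{n-1})} ⋯ X_{T_1}^{u(T_{n-1}, …, T_2)}`. -/
noncomputable def chainProd : (n : ℕ) → (u : NormalForm n) → Chain n u → MvPolynomial ℕ ℤ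
  | 0, _, _ => 1
  | 1, _, _ => 1
  | n + 2, u, c => u.monomialX c.1.1 * chainProd (n + 1) (u.step c.1) c.2

end NormalForm

end SchubertQ

namespace SchubertQ

open MvPolynomial

/-! ### Single divided differences and their relations -/

section DividedDifference

/-! Induct on `n`, peeling off the last factor `s_{n-1,i}` of the normal form. Applied to the
staircase monomial of `S_n`, this factor gives `X[1, i-1]` times the staircase monomial of `S_{n-1}`
(`ddWord_descWord_staircase`). The remaining factors are then moved past `X[1, k]`, starting from `k
= i - 1`, from right to left. A factor without the letter `s_k` commutes with `X[1, k]`, which is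
symmetric under all its letters. A factor with this letter obeys a Leibniz rule
(`ddWord_descWord_prodX_mul`): `X[1, k]` turns into `X[1, k-1]`, and one sums over the letter that
is omitted, or over omitting none at the cost of a new variable. The factors met in the second way
are exactly those numbered `q_1 > q_2 > ⋯ > q_m`, so one pass yields the sum over the vectors `T`
(`ddWord_fullWord_prodX_mul`).

What remains is a sum of words of `S_{n-1}` applied to the smaller staircase monomial. The `∂_i`
satisfy the nilCoxeter relations: `∂_i² = 0`, commutation and braid. Hence a word that is not
reduced acts as zero, and a reduced word acts as its normal form (`ddWord_of_not_isReduced`,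
`ddWord_of_isReduced`), so the induction hypothesis applies to `u(T)`.

The formula is a sum of products of monomials with coefficient one, and every Schubert polynomial is
of the form `∂_v` of a staircase monomial with `v` a normal form. Nonnegativity follows. -/

theorem dd_spec (i : ℕ) (f : MvPolynomial ℕ ℤ) :
    f - rename (Equiv.swap i (i + 1)) f = (X i - X (i + 1)) * dd i f :=
  (X_sub_X_dvd i f).choose_spec

theorem X_sub_X_ne_zero {i j : ℕ} (h : i ≠ j) : (X i - X j : MvPolynomial ℕ ℤ) ≠ 0 :=
  sub_ne_zero.2 fun e => h (X_injective e)

theorem dd_eq_of_eq {i : ℕ} {f g : MvPolynomial ℕ ℤ}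
    (h : f - rename (Equiv.swap i (i + 1)) f = (X i - X (i + 1)) * g) : dd i f = g :=
  mul_left_cancel₀ (X_sub_X_ne_zero (Nat.succ_ne_self i).symm) ((dd_spec i f).symm.trans h)

theorem dd_add (i : ℕ) (f g : MvPolynomial ℕ ℤ) : dd i (f + g) = dd i f + dd i g :=
  dd_eq_of_eq <| by
    rw [map_add]
    linear_combination dd_spec i f + dd_spec i g

theorem dd_eq_zero_of_symm {i : ℕ} {f : MvPolynomial ℕ ℤ}
    (h : rename (Equiv.swap i (i + 1)) f = f) : dd i f = 0 :=
  dd_eq_of_eq <| by rw [h, sub_self, mul_zero]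

theorem dd_mul_of_symm {i : ℕ} {p : MvPolynomial ℕ ℤ}
    (h : rename (Equiv.swap i (i + 1)) p = p) (f : MvPolynomial ℕ ℤ) :
    dd i (p * f) = p * dd i f :=
  dd_eq_of_eq <| by
    rw [map_mul, h]
    linear_combination p * dd_spec i f

/-- The only case of the Leibniz rule in which a non-symmetric factor is needed. Both terms carry a
plus sign, which is the source of positivity; in the first term the letter is omitted. -/
theorem dd_X_mul (i : ℕ) (f : MvPolynomial ℕ ℤ) :
    dd i (X i * f) = f + X (i + 1) * dd i f :=
  dd_eq_of_eq <| by
    rw [map_mul, rename_X, Equiv.swap_apply_left]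
    linear_combination X (i + 1) * dd_spec i f

theorem rename_swap_rename_swap (i j : ℕ) (f : MvPolynomial ℕ ℤ) :
    rename (Equiv.swap i j) (rename (Equiv.swap i j) f) = f := by
  have : (Equiv.swap i j ∘ Equiv.swap i j : ℕ → ℕ) = id := by
    ext x
    simp
  rw [rename_rename, this, rename_id_apply]

theorem rename_dd (i : ℕ) (f : MvPolynomial ℕ ℤ) :
    rename (Equiv.swap i (i + 1)) (dd i f) = dd i f := by
  have h := congrArg (rename (Equiv.swap i (i + 1))) (dd_spec i f)
  simp only [map_sub, map_mul, rename_X, Equiv.swap_apply_left, Equiv.swap_apply_right,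
    rename_swap_rename_swap] at h
  exact (dd_eq_of_eq (by linear_combination -h)).symm

theorem dd_dd_self (i : ℕ) (f : MvPolynomial ℕ ℤ) : dd i (dd i f) = 0 :=
  dd_eq_zero_of_symm (rename_dd i f)

theorem dd_comm {i j : ℕ} (h : i + 1 < j) (f : MvPolynomial ℕ ℤ) :
    dd i (dd j f) = dd j (dd i f) := by
  have h1 := congrArg (rename (Equiv.swap j (j + 1))) (dd_spec i f)
  have e1 : Equiv.swap j (j + 1) i = i :=
    Equiv.swap_apply_of_ne_of_ne (by omega) (by omega)
  have e2 : Equiv.swap j (j + 1) (i + 1) = i + 1 :=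
    Equiv.swap_apply_of_ne_of_ne (by omega) (by omega)
  have e3 : Equiv.swap i (i + 1) j = j :=
    Equiv.swap_apply_of_ne_of_ne (by omega) (by omega)
  have e4 : Equiv.swap i (i + 1) (j + 1) = j + 1 :=
    Equiv.swap_apply_of_ne_of_ne (by omega) (by omega)
  have h2 := congrArg (rename (Equiv.swap i (i + 1))) (dd_spec j f)
  have hc : rename (Equiv.swap j (j + 1)) (rename (Equiv.swap i (i + 1)) f) =
      rename (Equiv.swap i (i + 1)) (rename (Equiv.swap j (j + 1)) f) := by
    rw [rename_rename, rename_rename]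
    congr 2
    ext x
    simp only [Function.comp_apply, Equiv.swap_apply_def]
    split_ifs <;> omega
  simp only [map_sub, map_mul, rename_X, e1, e2, e3, e4, hc] at h1 h2
  apply mul_left_cancel₀ (mul_ne_zero (X_sub_X_ne_zero (show i ≠ i + 1 by omega))
    (X_sub_X_ne_zero (show j ≠ j + 1 by omega)))
  linear_combination -(X j - X (j + 1)) * dd_spec i (dd j f) +
    (X i - X (i + 1)) * dd_spec j (dd i f) - dd_spec j f + h2 + dd_spec i f - h1

/-- After multiplication by `(x - y)(y - z)(x - z)`, both sides become the alternating sum of the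
images of `f` under the permutations of the three variables. The two expressions for the longest
permutation agree by `hb`. -/
theorem dd_braid (i : ℕ) (f : MvPolynomial ℕ ℤ) :
    dd i (dd (i + 1) (dd i f)) = dd (i + 1) (dd i (dd (i + 1) f)) := by
  have a0 : Equiv.swap i (i + 1) i = i + 1 := Equiv.swap_apply_left _ _
  have a1 : Equiv.swap i (i + 1) (i + 1) = i := Equiv.swap_apply_right _ _
  have a2 : Equiv.swap i (i + 1) (i + 2) = i + 2 :=
    Equiv.swap_apply_of_ne_of_ne (by omega) (by omega)
  have b0 : Equiv.swap (i + 1) (i + 2) i = i :=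
    Equiv.swap_apply_of_ne_of_ne (by omega) (by omega)
  have b1 : Equiv.swap (i + 1) (i + 2) (i + 1) = i + 2 := Equiv.swap_apply_left _ _
  have b2 : Equiv.swap (i + 1) (i + 2) (i + 2) = i + 1 := Equiv.swap_apply_right _ _
  have hb : ∀ g : MvPolynomial ℕ ℤ, rename (Equiv.swap i (i + 1))
      (rename (Equiv.swap (i + 1) (i + 2)) (rename (Equiv.swap i (i + 1)) g)) =
      rename (Equiv.swap (i + 1) (i + 2))
        (rename (Equiv.swap i (i + 1)) (rename (Equiv.swap (i + 1) (i + 2)) g)) := by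
    intro g
    simp only [rename_rename]
    congr 2
    ext x
    simp only [Function.comp_apply, Equiv.swap_apply_def]
    split_ifs <;> omega
  have sa := dd_spec i
  have sb : ∀ g : MvPolynomial ℕ ℤ, g - rename (Equiv.swap (i + 1) (i + 2)) g =
    (X (i + 1) - X (i + 2)) * dd (i + 1) g := dd_spec (i + 1)
  have p2 := congrArg (rename (Equiv.swap (i + 1) (i + 2))) (sa f)
  have p4 := congrArg (rename (Equiv.swap i (i + 1))) p2
  have p5 := congrArg (rename (Equiv.swap i (i + 1))) (sb (dd i f))
  have p7 := congrArg (rename (Equiv.swap i (i + 1))) (sb f)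
  have p9 := congrArg (rename (Equiv.swap (i + 1) (i + 2))) p7
  have p10 := congrArg (rename (Equiv.swap (i + 1) (i + 2))) (sa (dd (i + 1) f))
  have ra := rename_dd i f
  have rb : rename (Equiv.swap (i + 1) (i + 2)) (dd (i + 1) f) = dd (i + 1) f :=
    rename_dd (i + 1) f
  have q1 := sa (dd (i + 1) (dd i f))
  have q2 := sb (dd i f)
  have q3 := sb (dd i (dd (i + 1) f))
  have q4 := sa (dd (i + 1) f)
  have q5 := sa f
  have q6 := sb f
  simp only [map_sub, map_mul, rename_X, a0, a1, a2, b0, b1, b2, hb, ra, rb] at *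
  generalize rename (Equiv.swap i (i + 1)) (dd (i + 1) (dd i f)) = A1 at *
  generalize rename (Equiv.swap (i + 1) (i + 2)) (dd i (dd (i + 1) f)) = A2 at *
  generalize dd i (dd (i + 1) (dd i f)) = L at *
  generalize dd (i + 1) (dd i (dd (i + 1) f)) = R at *
  have hxy := X_sub_X_ne_zero (show i ≠ i + 1 by omega)
  have hyz := X_sub_X_ne_zero (show i + 1 ≠ i + 2 by omega)
  have hxz := X_sub_X_ne_zero (show i ≠ i + 2 by omega)
  generalize (X i : MvPolynomial ℕ ℤ) = x at *
  generalize (X (i + 1) : MvPolynomial ℕ ℤ) = y at *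
  generalize (X (i + 2) : MvPolynomial ℕ ℤ) = z at *
  apply mul_left_cancel₀ (mul_ne_zero (mul_ne_zero hxy hyz) hxz)
  linear_combination -(x - z) * (y - z) * q1 - (x - z) * q2 + (y - z) * p5 - q5 + p2 - p4 +
    (x - z) * (x - y) * q3 + (x - z) * q4 - (x - y) * p10 + q6 - p7 + p9

end DividedDifference

/-! ### Operators attached to words -/

section DividedDifferenceWord

theorem dd_zero (i : ℕ) : dd i 0 = 0 := dd_eq_zero_of_symm (map_zero _)

theorem ddWord_nil (f : MvPolynomial ℕ ℤ) : ddWord [] f = f := rfl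

theorem ddWord_cons (a : ℕ) (w : List ℕ) (f : MvPolynomial ℕ ℤ) :
    ddWord (a :: w) f = dd a (ddWord w f) := rfl

theorem ddWord_append (v w : List ℕ) (f : MvPolynomial ℕ ℤ) :
    ddWord (v ++ w) f = ddWord v (ddWord w f) := List.foldr_append

theorem ddWord_zero (w : List ℕ) : ddWord w 0 = 0 := by
  induction w with
  | nil => rfl
  | cons a w ih => rw [ddWord_cons, ih, dd_zero]

theorem ddWord_add (w : List ℕ) (f g : MvPolynomial ℕ ℤ) :
    ddWord w (f + g) = ddWord w f + ddWord w g := by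
  induction w with
  | nil => rfl
  | cons a w ih => rw [ddWord_cons, ih, dd_add]; rfl

theorem ddWord_sum {ι : Type*} (w : List ℕ) (s : Finset ι) (f : ι → MvPolynomial ℕ ℤ) :
    ddWord w (∑ t ∈ s, f t) = ∑ t ∈ s, ddWord w (f t) := by
  classical
  induction s using Finset.induction_on with
  | empty => simp [ddWord_zero]
  | insert a s ha ih => rw [Finset.sum_insert ha, Finset.sum_insert ha, ddWord_add, ih]

theorem ddWord_mul_of_symm {w : List ℕ} {p : MvPolynomial ℕ ℤ}
    (h : ∀ a ∈ w, rename (Equiv.swap a (a + 1)) p = p) (f : MvPolynomial ℕ ℤ) :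
    ddWord w (p * f) = p * ddWord w f := by
  induction w with
  | nil => rfl
  | cons a w ih =>
    rw [List.forall_mem_cons] at h
    rw [ddWord_cons, ih h.2, dd_mul_of_symm h.1, ddWord_cons]

end DividedDifferenceWord

/-! ### The words `s_{j,i}` -/

section DescWord

theorem descWord_eq_nil {j i : ℕ} (h : j < i) : descWord j i = [] := by
  simp [descWord, show j + 1 - i = 0 by omega]

theorem descWord_succ {j i : ℕ} (h : i ≤ j + 1) :
    descWord (j + 1) i = (j + 1) :: descWord j i := by
  have : j + 1 + 1 - i = (j + 1 - i) + 1 := by omega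
  simp only [descWord, this, List.range'_concat, List.reverse_append]
  simp only [one_mul, List.reverse_cons, List.reverse_nil, List.nil_append,
    List.singleton_append, List.cons.injEq, and_true]
  omega

theorem descWord_append {j k i : ℕ} (h1 : i ≤ k + 1) (h2 : k ≤ j) :
    descWord j (k + 1) ++ descWord k i = descWord j i := by
  induction j, h2 using Nat.le_induction with
  | base => rw [descWord_eq_nil (Nat.lt_succ_self k), List.nil_append]
  | succ j hj ih =>
    rw [descWord_succ (by omega), descWord_succ (by omega), List.cons_append, ih]

theorem descWord_self (k : ℕ) : descWord k k = [k] := by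
  simp [descWord]

end DescWord

/-! ### NilCoxeter relations: a word acts as its normal form or as zero -/

section NilCoxeter

/-- Two words that agree in length, in the permutation and in the divided difference operator
that they represent. -/
structure NilEquiv (v w : List ℕ) : Prop where
  length_eq : v.length = w.length
  perm_eq : perm v = perm w
  ddWord_eq : ∀ f, ddWord v f = ddWord w f

/-- A word in `s_1, …, s_{n-1}` that acts as zero and represents the same permutation as a shorter
word. -/
structure Vanishing (n : ℕ) (w : List ℕ) : Prop where
  ddWord_eq_zero : ∀ f, ddWord w f = 0
  exists_shorter : ∃ v, IsWord n v ∧ perm v = perm w ∧ v.length < w.length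

theorem NilEquiv.refl (w : List ℕ) : NilEquiv w w := ⟨rfl, rfl, fun _ => rfl⟩

theorem NilEquiv.trans {u v w : List ℕ} (h : NilEquiv u v) (h' : NilEquiv v w) : NilEquiv u w :=
  ⟨h.1.trans h'.1, h.2.trans h'.2, fun f => (h.3 f).trans (h'.3 f)⟩

theorem NilEquiv.append {v v' w w' : List ℕ} (h : NilEquiv v v') (h' : NilEquiv w w') :
    NilEquiv (v ++ w) (v' ++ w') :=
  ⟨by simp [h.1, h'.1], by simp [perm_append, h.2, h'.2],
    fun f => by rw [ddWord_append, ddWord_append, h.3, h'.3]⟩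

theorem IsWord.append {n : ℕ} {v w : List ℕ} (hv : IsWord n v) (hw : IsWord n w) :
    IsWord n (v ++ w) := by
  intro a ha
  rcases List.mem_append.1 ha with h | h
  exacts [hv a h, hw a h]

theorem IsWord.mono {n m : ℕ} (hnm : n ≤ m) {w : List ℕ} (hw : IsWord n w) : IsWord m w :=
  fun a ha => ⟨(hw a ha).1, (hw a ha).2.trans_le hnm⟩

theorem isWord_descWord {n j i : ℕ} (hi : 1 ≤ i) (hj : j < n) : IsWord n (descWord j i) := by
  intro a ha
  rw [mem_descWord] at ha
  omega

theorem Vanishing.mono {n m : ℕ} (hnm : n ≤ m) {w : List ℕ} (h : Vanishing n w) :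
    Vanishing m w := by
  obtain ⟨h1, v, hv, h2⟩ := h
  exact ⟨h1, v, hv.mono hnm, h2⟩

theorem Vanishing.of_nilEquiv {n : ℕ} {v w : List ℕ} (h : NilEquiv v w) (hw : Vanishing n w) :
    Vanishing n v := by
  obtain ⟨h1, x, hx, h2, h3⟩ := hw
  exact ⟨fun f => by rw [h.3, h1], x, hx, h2.trans h.2.symm, by rwa [h.1]⟩

theorem Vanishing.append_right {n : ℕ} {v w : List ℕ} (hv : Vanishing n v) (hw : IsWord n w) :
    Vanishing n (v ++ w) := by
  obtain ⟨h1, x, hx, h2, h3⟩ := hv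
  exact ⟨fun f => by rw [ddWord_append, h1], x ++ w, hx.append hw,
    by rw [perm_append, perm_append, h2], by simpa⟩

theorem Vanishing.append_left {n : ℕ} {v w : List ℕ} (hv : IsWord n v) (hw : Vanishing n w) :
    Vanishing n (v ++ w) := by
  obtain ⟨h1, x, hx, h2, h3⟩ := hw
  exact ⟨fun f => by rw [ddWord_append, h1, ddWord_zero], v ++ x, hv.append hx,
    by rw [perm_append, perm_append, h2], by simpa⟩

theorem vanishing_pair {n a : ℕ} : Vanishing n [a, a] :=
  ⟨fun f => dd_dd_self a f, [], by simp [IsWord], by simp [perm, simple], by simp⟩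

theorem nilEquiv_comm {a b : ℕ} (h : a + 1 < b ∨ b + 1 < a) : NilEquiv [b, a] [a, b] := by
  refine ⟨rfl, ?_, fun f => ?_⟩
  · ext x
    simp only [perm, List.map_cons, List.map_nil, List.prod_cons, List.prod_nil, mul_one, simple,
      Equiv.Perm.mul_apply, Equiv.swap_apply_def]
    split_ifs <;> omega
  · rcases h with h | h
    · exact (dd_comm h f).symm
    · exact dd_comm h f

theorem nilEquiv_braid (a : ℕ) : NilEquiv [a + 1, a, a + 1] [a, a + 1, a] := by
  refine ⟨rfl, ?_, fun f => (dd_braid a f).symm⟩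
  ext x
  simp only [perm, List.map_cons, List.map_nil, List.prod_cons, List.prod_nil, mul_one, simple,
    Equiv.Perm.mul_apply, Equiv.swap_apply_def]
  split_ifs <;> omega

theorem nilEquiv_append_singleton {a : ℕ} {w : List ℕ} (h : ∀ b ∈ w, a + 1 < b ∨ b + 1 < a) :
    NilEquiv (w ++ [a]) ([a] ++ w) := by
  induction w with
  | nil => exact .refl _
  | cons b w ih =>
    rw [List.forall_mem_cons] at h
    have h1 : NilEquiv ([b] ++ (w ++ [a])) ([b] ++ ([a] ++ w)) := (NilEquiv.refl _).append (ih h.2)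
    have h2 : NilEquiv ([b, a] ++ w) ([a, b] ++ w) := (nilEquiv_comm h.1).append (.refl w)
    exact h1.trans h2

theorem nilEquiv_descWord_append_of_lt {j i a : ℕ} (h : a + 1 < i) :
    NilEquiv (descWord j i ++ [a]) ([a] ++ descWord j i) :=
  nilEquiv_append_singleton fun b hb => by
    rw [mem_descWord] at hb
    omega

/-- The new letter commutes with the letters below `s_a`, the braid relation turns `s_{a+1} s_a
s_{a+1}` into `s_a s_{a+1} s_a`, and the leading `s_a` commutes with the letters above `s_{a+1}`. -/
theorem nilEquiv_descWord_append_of_le {j i a : ℕ} (h0 : 1 ≤ i) (h1 : i ≤ a) (h2 : a + 1 ≤ j) :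
    NilEquiv (descWord j i ++ [a + 1]) ([a] ++ descWord j i) := by
  obtain ⟨c, rfl⟩ : ∃ c, a = c + 1 := ⟨a - 1, by omega⟩
  have e : descWord j i = descWord j (c + 3) ++ ([c + 2, c + 1] ++ descWord c i) := by
    rw [← descWord_append (k := c + 2) (by omega) h2, descWord_succ (by omega),
      descWord_succ (by omega)]
    rfl
  have s1 : NilEquiv (descWord c i ++ [c + 2]) ([c + 2] ++ descWord c i) :=
    nilEquiv_append_singleton fun b hb => by
      rw [mem_descWord] at hb
      omega
  have s2 : NilEquiv (descWord j (c + 3) ++ [c + 1]) ([c + 1] ++ descWord j (c + 3)) :=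
    nilEquiv_descWord_append_of_lt (by omega)
  have t1 := (NilEquiv.refl (descWord j (c + 3) ++ [c + 2, c + 1])).append s1
  have t2 := ((NilEquiv.refl (descWord j (c + 3))).append (nilEquiv_braid (c + 1))).append
    (.refl (descWord c i))
  have t3 := s2.append (.refl ([c + 2, c + 1] ++ descWord c i))
  rw [e]
  simp only [List.append_assoc, List.cons_append, List.nil_append] at t1 t2 t3 ⊢
  exact t1.trans (t2.trans t3)

theorem NormalForm.init_snoc {n : ℕ} (v : NormalForm n) (a : ℕ) (h1 : 1 ≤ a) (h2 : a ≤ n + 1) :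
    (v.snoc a h1 h2).init = v := by
  ext j
  simp only [NormalForm.init, NormalForm.snoc]
  split_ifs with h1 h2
  · omega
  · rfl
  · exact (v.eq_of_ge j (by omega)).symm

theorem NormalForm.word_snoc {n : ℕ} (hn : 1 ≤ n) (v : NormalForm n) (a : ℕ) (h1 : 1 ≤ a)
    (h2 : a ≤ n + 1) : (v.snoc a h1 h2).word = v.word ++ descWord n a := by
  rw [NormalForm.word_succ hn, NormalForm.init_snoc]
  simp [NormalForm.snoc]

/-- Compare `a` with the last factor `s_{n,i}`. For `a + 1 < i` the letter passes through unchanged,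
and for `a > i` it passes as `s_{a-1}`; in both cases induction treats the shorter normal form. For
`a + 1 = i` it lengthens the factor, and for `a = i` it creates a square. -/
theorem nilEquiv_or_vanishing_word_append (n : ℕ) (hn : 1 ≤ n) (u : NormalForm n) (a : ℕ)
    (h1 : 1 ≤ a) (h2 : a < n) :
    (∃ u' : NormalForm n, NilEquiv (u.word ++ [a]) u'.word) ∨ Vanishing n (u.word ++ [a]) := by
  induction n, hn using Nat.le_induction generalizing a with
  | base => omega
  | succ n hn ih =>
    have hle := u.le n
    have hone := u.one_le n
    have key : ∀ b, 1 ≤ b → b < n →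
        NilEquiv (descWord n (u.i n) ++ [a]) ([b] ++ descWord n (u.i n)) →
        (∃ u' : NormalForm (n + 1), NilEquiv (u.word ++ [a]) u'.word) ∨
          Vanishing (n + 1) (u.word ++ [a]) := by
      intro b hb1 hb2 hE
      have hE' : NilEquiv (u.word ++ [a]) ((u.init.word ++ [b]) ++ descWord n (u.i n)) := by
        rw [NormalForm.word_succ hn, List.append_assoc, List.append_assoc]
        exact (NilEquiv.refl _).append hE
      rcases ih u.init b hb1 hb2 with ⟨v, hv⟩ | hv
      · refine .inl ⟨v.snoc (u.i n) hone hle, ?_⟩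
        rw [NormalForm.word_snoc hn]
        exact hE'.trans (hv.append (.refl _))
      · exact .inr <| .of_nilEquiv hE' <|
          (hv.mono (Nat.le_succ n)).append_right (isWord_descWord hone (Nat.lt_succ_self n))
    rcases lt_trichotomy (a + 1) (u.i n) with h | h | h
    · exact key a h1 (by omega) (nilEquiv_descWord_append_of_lt h)
    · refine .inl ⟨u.init.snoc a h1 (by omega), ?_⟩
      rw [NormalForm.word_snoc hn, NormalForm.word_succ hn, List.append_assoc, ← h,
        ← descWord_append (j := n) (k := a) (i := a) (by omega) (by omega), descWord_self]
      exact .refl _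
    · rcases (Nat.lt_succ_iff.1 h).eq_or_lt with h' | h'
      · refine .inr ?_
        rw [NormalForm.word_succ hn, h',
          ← descWord_append (j := n) (k := a) (i := a) (by omega) (by omega), descWord_self,
          List.append_assoc, List.append_assoc]
        refine .append_left ?_ (.append_left (isWord_descWord (by omega) (by omega))
          vanishing_pair)
        exact u.init.isWord.mono (Nat.le_succ n)
      · obtain ⟨b, rfl⟩ : ∃ b, a = b + 1 := ⟨a - 1, by omega⟩
        exact key b (by omega) (by omega)
          (nilEquiv_descWord_append_of_le hone (by omega) (by omega))

theorem NormalForm.perm_injective {n : ℕ} (hn : 1 ≤ n) {u v : NormalForm n}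
    (h : perm u.word = perm v.word) : u = v :=
  (existsUnique_normalForm n hn _ (perm_mem v.isWord)).unique h rfl

theorem perm_word_normalForm {n : ℕ} (hn : 1 ≤ n) {g : Equiv.Perm ℕ} (hg : g ∈ SymGroup n) :
    perm (normalForm n hn g hg).word = g :=
  (existsUnique_normalForm n hn g hg).choose_spec.1

theorem exists_normalForm_word_eq_nil (n : ℕ) :
    ∃ u : NormalForm n, u.word = [] := by
  refine ⟨⟨fun j => j + 1, by simp, by simp, by simp⟩, ?_⟩
  simp only [NormalForm.word, List.flatMap_eq_nil_iff]
  exact fun j _ => descWord_eq_nil (Nat.lt_succ_self j)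

theorem normalForm_word_of_eq_one {n : ℕ} (hn : 1 ≤ n) {g : Equiv.Perm ℕ} (hg : g ∈ SymGroup n)
    (h : g = 1) : (normalForm n hn g hg).word = [] := by
  obtain ⟨u, hu⟩ := exists_normalForm_word_eq_nil n
  rw [NormalForm.perm_injective hn (u := normalForm n hn g hg) (v := u), hu]
  rw [perm_word_normalForm, hu, h]
  rfl

/-- Normal forms span the nilCoxeter algebra: read the word letter by letter and renormalise after
each one. -/
theorem nilEquiv_or_vanishing (n : ℕ) (hn : 1 ≤ n) (w : List ℕ) (hw : IsWord n w) :
    (∃ u : NormalForm n, NilEquiv w u.word) ∨ Vanishing n w := by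
  induction w using List.reverseRecOn with
  | nil =>
    obtain ⟨u, hu⟩ := exists_normalForm_word_eq_nil n
    exact .inl ⟨u, by rw [hu]; exact .refl _⟩
  | append_singleton w a ih =>
    have ha := hw a (by simp)
    have ha' : IsWord n [a] := by
      intro b hb
      rwa [List.mem_singleton.1 hb]
    rcases ih fun b hb => hw b (by simp [hb]) with ⟨u, hu⟩ | hv
    · have hE := hu.append (.refl [a])
      rcases nilEquiv_or_vanishing_word_append n hn u a ha.1 ha.2 with ⟨v, hv⟩ | hv
      · exact .inl ⟨v, hE.trans hv⟩
      · exact .inr (.of_nilEquiv hE hv)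
    · exact .inr (hv.append_right ha')

/-- A reduced word cannot be `Vanishing`, since that provides a shorter word; uniqueness of normal
forms then identifies the one it is equivalent to. -/
theorem ddWord_of_isReduced {n : ℕ} (hn : 1 ≤ n) {w : List ℕ} (hw : IsReduced n w)
    (h : perm w ∈ SymGroup n) (f : MvPolynomial ℕ ℤ) :
    ddWord w f = ddWord (normalForm n hn (perm w) h).word f := by
  rcases nilEquiv_or_vanishing n hn w hw.1 with ⟨u, hu⟩ | hv
  · rw [hu.ddWord_eq, NormalForm.perm_injective hn (u := normalForm n hn (perm w) h) (v := u)]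
    rw [perm_word_normalForm, hu.perm_eq]
  · obtain ⟨v, hv1, hv2, hv3⟩ := hv.exists_shorter
    exact absurd (hw.2 v hv1 hv2) (by omega)

theorem ddWord_of_not_isReduced {n : ℕ} (hn : 1 ≤ n) {w : List ℕ} (hw : IsWord n w)
    (h : ¬ IsReduced n w) (f : MvPolynomial ℕ ℤ) : ddWord w f = 0 := by
  rcases nilEquiv_or_vanishing n hn w hw with ⟨u, hu⟩ | hv
  · refine absurd ⟨hw, ?_⟩ h
    -- A word equivalent to a normal form has minimal length: a vanishing competitor is replaced by
    -- a shorter one until it too is equivalent to a normal form, which is then the same one and has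
    -- the length of `w`.
    have key : ∀ k v, v.length = k → IsWord n v → perm v = perm w → w.length ≤ v.length := by
      intro k
      induction k using Nat.strong_induction_on with
      | _ k ih =>
        intro v hk hv hvw
        rcases nilEquiv_or_vanishing n hn v hv with ⟨u', hu'⟩ | hz
        · have : u = u' := NormalForm.perm_injective hn
            (by rw [← hu.perm_eq, ← hu'.perm_eq, hvw])
          rw [hu.length_eq, hu'.length_eq, this]
        · obtain ⟨x, hx1, hx2, hx3⟩ := hz.exists_shorter
          exact (ih _ (hk ▸ hx3) x rfl hx1 (hx2.trans hvw)).trans hx3.le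
    exact fun v hv hvw => key _ v rfl hv hvw
  · exact hv.ddWord_eq_zero f

end NilCoxeter

/-! ### Moving words past `X[1, k]` -/

/-- The monomial `X[1, k] = x_1 x_2 ⋯ x_k`. -/
noncomputable def prodX (k : ℕ) : MvPolynomial ℕ ℤ := ∏ j ∈ Finset.Icc 1 k, X j

theorem prodX_succ (k : ℕ) : prodX (k + 1) = prodX k * X (k + 1) :=
  Finset.prod_Icc_succ_top (by omega) _

theorem rename_swap_prod {i : ℕ} {s : Finset ℕ} (h1 : i ∉ s) (h2 : i + 1 ∉ s) (e : ℕ → ℕ) :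
    rename (Equiv.swap i (i + 1)) (∏ k ∈ s, X k ^ e k : MvPolynomial ℕ ℤ) =
      ∏ k ∈ s, X k ^ e k := by
  rw [map_prod]
  refine Finset.prod_congr rfl fun k hk => ?_
  rw [map_pow, rename_X, Equiv.swap_apply_of_ne_of_ne]
  · rintro rfl; exact h1 hk
  · rintro rfl; exact h2 hk

/-- Either both of `x_a`, `x_{a+1}` occur in the product or neither does; `a = 0` is excluded
because `x_0` never occurs. -/
theorem rename_swap_prodX {a k : ℕ} (ha : 1 ≤ a) (h : a ≠ k) :
    rename (Equiv.swap a (a + 1)) (prodX k) = prodX k := by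
  rcases lt_or_gt_of_ne h with h | h
  · simp only [prodX, map_prod, rename_X]
    refine Equiv.Perm.prod_comp (Equiv.swap a (a + 1)) (Finset.Icc 1 k)
      (fun j => (X j : MvPolynomial ℕ ℤ)) fun x hx => ?_
    rcases eq_or_ne x a with rfl | h1
    · simp; omega
    · rcases eq_or_ne x (a + 1) with rfl | h2
      · simp; omega
      · exact absurd (Equiv.swap_apply_of_ne_of_ne h1 h2) hx
  · have := rename_swap_prod (i := a) (s := Finset.Icc 1 k) (by simp; omega) (by simp; omega)
      fun _ => 1
    simpa [prodX] using this

theorem rename_swap_X {a k : ℕ} (h : a + 1 < k) :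
    rename (Equiv.swap a (a + 1)) (X k : MvPolynomial ℕ ℤ) = X k := by
  rw [rename_X, Equiv.swap_apply_of_ne_of_ne (by omega) (by omega)]

theorem rename_swap_X_pow {a k : ℕ} (h : a + 1 < k) (e : ℕ) :
    rename (Equiv.swap a (a + 1)) (X k ^ e : MvPolynomial ℕ ℤ) = X k ^ e := by
  rw [map_pow, rename_swap_X h]

/-- If the letter `s_k` occurs in `s_{j,i}`, then `∂_{s_{j,i}} X[1, k]` is `X[1, k - 1]` times a sum
over the omission of a letter `s_t` with `k ≤ t`, where `t = j + 1` omits nothing. -/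
theorem ddWord_descWord_prodX_mul {i j k : ℕ} (hi : 1 ≤ i) (hik : i ≤ k) (hkj : k ≤ j)
    (f : MvPolynomial ℕ ℤ) :
    ddWord (descWord j i) (prodX k * f) =
      prodX (k - 1) * ∑ t ∈ Finset.Icc k (j + 1),
        X (j + 1) ^ (if t > j then 1 else 0) *
          ddWord ((descWord j i).filter fun a => ¬ t = a) f := by
  obtain ⟨k, rfl⟩ : ∃ c, k = c + 1 := ⟨k - 1, by omega⟩
  rw [Nat.add_sub_cancel]
  have filt : ∀ j t, j < t → (descWord j i).filter (fun a => ¬ t = a) = descWord j i := by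
    intro j t h
    rw [List.filter_eq_self]
    intro a ha
    rw [mem_descWord] at ha
    simp
    omega
  induction j, hkj using Nat.le_induction with
  | base =>
    have hs : ∀ a ∈ descWord k i, rename (Equiv.swap a (a + 1)) (prodX (k + 1)) = prodX (k + 1) := by
      intro a ha
      rw [mem_descWord] at ha
      exact rename_swap_prodX (by omega) (by omega)
    have e : Finset.Icc (k + 1) (k + 1 + 1) = {k + 1, k + 2} := by
      ext; simp; omega
    have f1 : (descWord (k + 1) i).filter (fun a => ¬ k + 1 = a) = descWord k i := by
      rw [descWord_succ hik, List.filter_cons_of_neg (by simp), filt k (k + 1) (by omega)]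
    rw [e, Finset.sum_pair (by omega), f1, filt (k + 1) (k + 2) (by omega), descWord_succ hik,
      ddWord_cons, ddWord_cons, ddWord_mul_of_symm hs, prodX_succ, mul_assoc,
      dd_mul_of_symm (rename_swap_prodX (by omega) (by omega)), dd_X_mul]
    simp
  | succ j hj ih =>
    have hd : descWord (j + 1) i = (j + 1) :: descWord j i := descWord_succ (by omega)
    have hs : rename (Equiv.swap (j + 1) (j + 2)) (prodX k) = prodX k :=
      rename_swap_prodX (by omega) (by omega)
    have f1 : (descWord (j + 1) i).filter (fun a => ¬ j + 1 = a) = descWord j i := by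
      rw [hd, List.filter_cons_of_neg (by simp), filt j (j + 1) (by omega)]
    conv_lhs => rw [hd, ddWord_cons, ih]
    rw [dd_mul_of_symm hs, Finset.sum_Icc_succ_top (by omega),
      Finset.sum_Icc_succ_top (b := j + 1) (by omega), Finset.sum_Icc_succ_top (b := j) (by omega),
      f1, filt (j + 1) _ (by omega), filt j _ (by omega), dd_add]
    simp only [gt_iff_lt, lt_irrefl, if_false, Nat.lt_succ_self, if_true, pow_one, pow_zero,
      one_mul]
    -- The term `t = j + 1` of `ih` omits nothing and carries `x_{j+1}`. The Leibniz rule splits it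
    -- into the new terms `t = j + 1`, which omits `s_{j+1}`, and `t = j + 2`, which omits nothing
    -- and carries `x_{j+2}`. In the other terms `s_{j+1}` is merely prepended.
    rw [dd_X_mul, ← add_assoc, hd, ddWord_cons]
    congr 3
    have := ddWord_sum [j + 1] (Finset.Icc (k + 1) j) fun t =>
      X (j + 1) ^ (if t > j then 1 else 0) * ddWord ((descWord j i).filter fun a => ¬ t = a) f
    refine this.trans (Finset.sum_congr rfl fun t ht => ?_)
    rw [Finset.mem_Icc] at ht
    rw [if_neg (by omega), if_neg (by omega), pow_zero, pow_zero, one_mul, one_mul,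
      List.filter_cons_of_pos (by simp; omega)]
    rfl

/-- The word `s_{1,d_1} s_{2,d_2} ⋯ s_{K,d_K}` from which, for every `j`, the letter `t_j` of the
factor with number `q_j` is omitted. -/
def omitWord (d : ℕ → ℕ) (K : ℕ) {m : ℕ} (q : ℕ → ℕ) (t : Fin m → ℕ) : List ℕ :=
  (List.range' 1 K).flatMap fun k =>
    (descWord k (d k)).filter fun a => ¬ ∃ j : Fin m, q j = k ∧ t j = a

theorem omitWord_succ (d : ℕ → ℕ) (K : ℕ) {m : ℕ} (q : ℕ → ℕ) (t : Fin m → ℕ) :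
    omitWord d (K + 1) q t = omitWord d K q t ++
      (descWord (K + 1) (d (K + 1))).filter fun a => ¬ ∃ j : Fin m, q j = K + 1 ∧ t j = a := by
  simp only [omitWord, List.range'_concat, List.flatMap_append, List.flatMap_cons,
    List.flatMap_nil, List.append_nil, one_mul, Nat.add_comm 1 K]

/-- The word `s_{1,d_1} s_{2,d_2} ⋯ s_{K,d_K}`. -/
def fullWord (d : ℕ → ℕ) (K : ℕ) : List ℕ :=
  (List.range' 1 K).flatMap fun k => descWord k (d k)

theorem fullWord_succ (d : ℕ → ℕ) (K : ℕ) :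
    fullWord d (K + 1) = fullWord d K ++ descWord (K + 1) (d (K + 1)) := by
  simp only [fullWord, List.range'_concat, List.flatMap_append, List.flatMap_cons,
    List.flatMap_nil, List.append_nil, one_mul, Nat.add_comm 1 K]

theorem mem_fullWord {d : ℕ → ℕ} (hd : ∀ j, 1 ≤ d j) {K a : ℕ} (h : a ∈ fullWord d K) :
    1 ≤ a ∧ a ≤ K := by
  obtain ⟨k, hk, ha⟩ := List.mem_flatMap.1 h
  have ha := mem_descWord.1 ha
  rw [List.mem_range'_1] at hk
  have := hd k
  omega

theorem filter_not_exists_eq_self {m k : ℕ} {q : ℕ → ℕ} (h : ∀ j < m, q j ≠ k) (t : Fin m → ℕ)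
    (w : List ℕ) : w.filter (fun a => ¬ ∃ j : Fin m, q j = k ∧ t j = a) = w := by
  rw [List.filter_eq_self]
  intro a _
  simp only [decide_eq_true_eq]
  rintro ⟨j, hj, -⟩
  exact h j j.2 hj

theorem filter_not_exists_cons {m k : ℕ} {q : ℕ → ℕ} (h0 : q 0 = k)
    (h : ∀ j < m, q (j + 1) ≠ k) (s : ℕ) (t : Fin m → ℕ) (w : List ℕ) :
    w.filter (fun a => ¬ ∃ j : Fin (m + 1), q j = k ∧ (Fin.cons s t : Fin (m + 1) → ℕ) j = a) =
      w.filter fun a => ¬ s = a := by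
  refine List.filter_congr fun a _ => ?_
  congr 2
  rw [Fin.exists_fin_succ]
  simp only [Fin.val_zero, h0, Fin.cons_zero, true_and, Fin.val_succ, Fin.cons_succ, eq_iff_iff,
    or_iff_left_iff_imp]
  rintro ⟨j, hj, -⟩
  exact absurd hj (h j j.2)

theorem omitWord_cons {d : ℕ → ℕ} {K m : ℕ} {q : ℕ → ℕ} (h0 : K < q 0) (s : ℕ) (t : Fin m → ℕ) :
    omitWord d K q (Fin.cons s t : Fin (m + 1) → ℕ) = omitWord d K (fun j => q (j + 1)) t := by
  refine List.flatMap_congr fun k hk => List.filter_congr fun a _ => ?_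
  rw [List.mem_range'_1] at hk
  congr 2
  rw [Fin.exists_fin_succ]
  simp only [Fin.val_zero, show q 0 ≠ k by omega, false_and, Fin.val_succ, Fin.cons_succ, false_or]

/-- Commuting a full word past `X[1, k]`: the sum runs over the omitted letters `t_j`. -/
theorem ddWord_fullWord_prodX_mul {d : ℕ → ℕ} (hd : ∀ j, 1 ≤ d j) (K m k : ℕ) (q lo : ℕ → ℕ)
    (hlo : ∀ j < m, lo j = k - j)
    (h1 : ∀ j < m, 1 ≤ q j ∧ q j ≤ K ∧ d (q j) + j ≤ k ∧ k ≤ q j + j)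
    (h2 : ∀ i j, i < j → j < m → q j < q i)
    (h3 : ∀ p j, 1 ≤ p → p ≤ K → j ≤ m → (∀ i < j, p < q i) → (∀ i, j ≤ i → i < m → q i < p) →
      ¬ (d p + j ≤ k ∧ k ≤ p + j)) (f : MvPolynomial ℕ ℤ) :
    ddWord (fullWord d K) (prodX k * f) =
      ∑ t : ((j : Fin m) → Finset.Icc (lo j) (q j + 1)),
        (prodX (k - m) * ∏ j : Fin m, X (1 + q j) ^ (if (t j : ℕ) > q j then 1 else 0)) *
          ddWord (omitWord d K q fun j => (t j : ℕ)) f := by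
  -- By `h1` the factor `q j` contains `s_{k-j}`; by `h3` a factor strictly between `q j` and its
  -- predecessor does not contain this letter. The lower bounds are a separate function `lo`, so
  -- that the index type of the shifted problem matches without rewriting `k - (j + 1)` in a
  -- dependent type.
  induction K generalizing m k q lo f with
  | zero =>
    obtain rfl : m = 0 := by
      by_contra h
      have := h1 0 (by omega)
      omega
    simp [omitWord, fullWord, ddWord_nil]
  | succ K ih =>
    rw [fullWord_succ, ddWord_append]
    by_cases hm : 0 < m ∧ q 0 = K + 1
    · obtain ⟨hm, hq⟩ := hm
      obtain ⟨m, rfl⟩ : ∃ c, m = c + 1 := ⟨m - 1, by omega⟩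
      have h10 := h1 0 hm
      have hlo0 := hlo 0 hm
      rw [hq] at h10
      rw [ddWord_descWord_prodX_mul (hd _) (by omega) (by omega), Finset.mul_sum, ddWord_sum,
        ← (Fin.consEquiv fun j : Fin (m + 1) => Finset.Icc (lo j) (q j + 1)).sum_comp,
        Fintype.sum_prod_type]
      simp only [Fin.consEquiv_apply]
      have hIcc : Finset.Icc (lo (0 : Fin (m + 1))) (q (0 : Fin (m + 1)) + 1) =
          Finset.Icc k (K + 1 + 1) := by
        rw [Fin.val_zero, hlo0, hq, Nat.sub_zero]
      rw [← hIcc, ← Finset.sum_coe_sort]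
      refine Finset.sum_congr rfl fun s _ => ?_
      -- The remaining letters are at most `K`, so the newly created variable `x_{K+2}` moves freely
      -- to the left.
      have hs : ∀ a ∈ fullWord d K, rename (Equiv.swap a (a + 1))
          (X (K + 1 + 1) ^ (if (s : ℕ) > K + 1 then 1 else 0) : MvPolynomial ℕ ℤ) =
          X (K + 1 + 1) ^ (if (s : ℕ) > K + 1 then 1 else 0) := fun a ha =>
        rename_swap_X_pow (by have := mem_fullWord hd ha; omega) _
      rw [mul_left_comm, ddWord_mul_of_symm hs,
        ih m (k - 1) (fun j => q (j + 1)) (fun j => lo (j + 1)), Finset.mul_sum]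
      · refine Finset.sum_congr rfl fun t _ => ?_
        have e : (fun j => ((Fin.cons s t : (j : Fin (m + 1)) → Finset.Icc (lo j) (q j + 1)) j : ℕ)) =
            (Fin.cons (s : ℕ) (fun j => (t j : ℕ)) : Fin (m + 1) → ℕ) := by
          funext j
          refine Fin.cases rfl (fun j => rfl) j
        rw [e, omitWord_succ, omitWord_cons (by omega), filter_not_exists_cons hq, ddWord_append,
          Fin.prod_univ_succ, show k - (m + 1) = k - 1 - m by omega]
        · simp only [Fin.val_zero, Fin.cons_zero, Fin.val_succ, Fin.cons_succ, hq,
            Nat.add_comm 1 (K + 1)]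
          ring
        · intro j hj
          have := h2 0 (j + 1) (by omega) (by omega)
          omega
      · intro j hj
        rw [hlo (j + 1) (by omega)]
        omega
      · intro j hj
        have := h1 (j + 1) (by omega)
        have := h2 0 (j + 1) (by omega) (by omega)
        omega
      · intro i j hij hj
        exact h2 _ _ (by omega) (by omega)
      · intro p j hp hpK hj hlt hgt hc
        -- Positivity of `d p` ensures that `k - 1` is not a truncated subtraction here.
        have := hd p
        refine h3 p (j + 1) hp (by omega) (by omega) ?_ ?_ ⟨by omega, by omega⟩
        · rintro (_ | i) hi
          · omega
          · exact hlt i (by omega)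
        · rintro (_ | i) hi hi'
          · omega
          · exact hgt i (by omega) (by omega)
    · have hq : ∀ j < m, q j < K + 1 := by
        intro j hj
        have h10 := (h1 0 (by omega)).2.1
        rcases Nat.eq_zero_or_pos j with rfl | hj'
        · omega
        · have := h2 0 j hj' hj
          omega
      have hs : ∀ a ∈ descWord (K + 1) (d (K + 1)),
          rename (Equiv.swap a (a + 1)) (prodX k) = prodX k := by
        intro a ha
        rw [mem_descWord] at ha
        have := hd (K + 1)
        refine rename_swap_prodX (by omega) ?_
        rintro rfl
        -- All `q j` lie below `K + 1`, so `h3` with `j = 0` says that `s_k` is not a letter of this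
        -- factor.
        exact h3 (K + 1) 0 (by omega) le_rfl (Nat.zero_le _) (by simp)
          (fun i _ hi => hq i hi) (by omega)
      rw [ddWord_mul_of_symm hs, ih m k q lo hlo]
      · refine Finset.sum_congr rfl fun t _ => ?_
        rw [omitWord_succ, filter_not_exists_eq_self (fun j hj => (hq j hj).ne), ddWord_append]
      · intro j hj
        have := h1 j hj
        have := hq j hj
        omega
      · exact h2
      · intro p j hp hpK
        exact h3 p j hp (by omega)

/-! ### The last factor acting on the staircase monomial -/

/-- The monomial `x_1^{n-1} x_2^{n-2} ⋯ x_{n-1}`. -/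
noncomputable def staircase (n : ℕ) : MvPolynomial ℕ ℤ :=
  ∏ k ∈ Finset.Icc 1 (n - 1), X k ^ (n - k)

/-- When `∂_{j+1}` acts, the exponent of `x_{j+1}` exceeds that of `x_{j+2}` by one, so the
polynomial is `x_{j+1}` times something symmetric, and the operator just removes this `x_{j+1}`. The
trivial factor `x_{n+1}^0` is included so that `x_{j+2}` is always present. -/
theorem ddWord_descWord_prod (n i j : ℕ) (hi : 1 ≤ i) (hij : i ≤ j + 1) (hjn : j ≤ n) :
    ddWord (descWord j i) (∏ k ∈ Finset.Icc 1 (n + 1), X k ^ (n + 1 - k)) =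
      prodX (i - 1) * ((∏ k ∈ Finset.Icc 1 j, X k ^ (n - k)) *
        ∏ k ∈ Finset.Ioc j (n + 1), X k ^ (n + 1 - k)) := by
  obtain ⟨i, rfl⟩ : ∃ c, i = c + 1 := ⟨i - 1, by omega⟩
  rw [Nat.add_sub_cancel]
  replace hij : i ≤ j := by omega
  induction j, hij using Nat.le_induction with
  | base =>
    have e : (Finset.Icc 1 (n + 1) : Finset ℕ) = Finset.Icc 1 i ∪ Finset.Ioc i (n + 1) := by
      ext; simp; omega
    rw [descWord_eq_nil (Nat.lt_succ_self i), ddWord_nil, e, Finset.prod_union, ← mul_assoc,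
      prodX, ← Finset.prod_mul_distrib]
    · congr 1
      refine Finset.prod_congr rfl fun k hk => ?_
      rw [Finset.mem_Icc] at hk
      rw [← pow_succ', show n - k + 1 = n + 1 - k by omega]
    · rw [Finset.disjoint_left]
      intro a
      simp
      omega
  | succ j hj ih =>
    rw [descWord_succ (by omega), ddWord_cons, ih (by omega)]
    have e : Finset.Ioc j (n + 1) = insert (j + 1) (insert (j + 2) (Finset.Ioc (j + 2) (n + 1))) := by
      ext; simp; omega
    have e' : Finset.Ioc (j + 1) (n + 1) = insert (j + 2) (Finset.Ioc (j + 2) (n + 1)) := by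
      ext; simp; omega
    rw [e, e', Finset.prod_insert (by simp), Finset.prod_insert (by simp),
      Finset.prod_Icc_succ_top (by omega), show n + 1 - (j + 1) = n - (j + 1) + 1 by omega,
      show n + 1 - (j + 2) = n - (j + 1) by omega]
    have hs : rename (Equiv.swap (j + 1) (j + 1 + 1)) (prodX i * ((∏ k ∈ Finset.Icc 1 j, X k ^ (n - k)) *
        (X (j + 1) ^ (n - (j + 1)) * (X (j + 2) ^ (n - (j + 1)) *
          ∏ k ∈ Finset.Ioc (j + 2) (n + 1), X k ^ (n + 1 - k))) : MvPolynomial ℕ ℤ)) =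
        prodX i * ((∏ k ∈ Finset.Icc 1 j, X k ^ (n - k)) *
        (X (j + 1) ^ (n - (j + 1)) * (X (j + 2) ^ (n - (j + 1)) *
          ∏ k ∈ Finset.Ioc (j + 2) (n + 1), X k ^ (n + 1 - k)))) := by
      rw [map_mul, rename_swap_prodX (by omega) (by omega), map_mul, map_mul, map_mul,
        rename_swap_prod (by simp) (by simp), rename_swap_prod (by simp) (by simp), map_pow,
        map_pow, rename_X, rename_X, Equiv.swap_apply_left, Equiv.swap_apply_right]
      ring
    have h := dd_X_mul (j + 1) (prodX i * ((∏ k ∈ Finset.Icc 1 j, X k ^ (n - k)) *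
        (X (j + 1) ^ (n - (j + 1)) * (X (j + 2) ^ (n - (j + 1)) *
          ∏ k ∈ Finset.Ioc (j + 2) (n + 1), X k ^ (n + 1 - k))) : MvPolynomial ℕ ℤ))
    rw [dd_eq_zero_of_symm hs, mul_zero, add_zero] at h
    refine (congrArg _ ?_).trans (h.trans ?_)
    · ring
    · ring

theorem ddWord_descWord_staircase (n i : ℕ) (hi : 1 ≤ i) (hin : i ≤ n + 1) :
    ddWord (descWord n i) (staircase (n + 1)) = prodX (i - 1) * staircase n := by
  have e1 : staircase (n + 1) = ∏ k ∈ Finset.Icc 1 (n + 1), X k ^ (n + 1 - k) := by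
    rw [Finset.prod_Icc_succ_top (by omega), Nat.sub_self, pow_zero, mul_one]
    rfl
  have e2 : staircase n = ∏ k ∈ Finset.Icc 1 n, X k ^ (n - k) := by
    rcases n with _ | n
    · rfl
    · rw [Finset.prod_Icc_succ_top (by omega), Nat.sub_self, pow_zero, mul_one]
      rfl
  rw [e1, ddWord_descWord_prod n i n hi hin le_rfl, e2]
  simp

/-! ### The recursion for `∂_u` and the sum over chains -/

namespace NormalForm

variable {n : ℕ}

theorem mem_M {u : NormalForm n} {r l q j : ℕ} :
    j ∈ u.M r l q ↔ (1 ≤ j ∧ j < q) ∧ u.i j + l ≤ u.i r ∧ u.i r ≤ j + l := by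
  simp [M]

theorem q_succ_mem (u : NormalForm n) {r l : ℕ} (h : l < u.m r) :
    u.q r (l + 1) ∈ u.M r (l + 1) (u.q r l) := by
  have := Nat.find_min (u.exists_M_eq_empty r) h
  obtain ⟨j, hj, e⟩ := Finset.exists_mem_eq_sup _ (Finset.nonempty_iff_ne_empty.2 this) id
  rw [q, e]
  exact hj

theorem q_succ_lt (u : NormalForm n) {r l : ℕ} (h : l < u.m r) : u.q r (l + 1) < u.q r l :=
  (mem_M.1 (u.q_succ_mem h)).1.2

theorem q_lt_q (u : NormalForm n) {r i j : ℕ} (hij : i < j) (h : j ≤ u.m r) :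
    u.q r j < u.q r i := by
  induction j, hij using Nat.le_induction with
  | base => exact u.q_succ_lt h
  | succ j hj ih => exact (u.q_succ_lt h).trans (ih (by omega))

/-- Maximality of `q_{r,l+1}`, together with the emptiness of the set at `l = m_r`. Beyond `m_r` the
value of `q` is a default, hence the last alternative. -/
theorem le_q_succ (u : NormalForm n) {r l p : ℕ} (h : p ∈ u.M r (l + 1) (u.q r l)) :
    l < u.m r ∧ p ≤ u.q r (l + 1) ∨ u.m r < l := by
  rcases lt_trichotomy l (u.m r) with hl | rfl | hl
  · exact .inl ⟨hl, Finset.le_sup (f := id) h⟩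
  · rw [show u.M r (u.m r + 1) (u.q r (u.m r)) = ∅ from Nat.find_spec (u.exists_M_eq_empty r)] at h
    simp at h
  · exact .inr hl

theorem ddWord_word_staircase (u : NormalForm (n + 2)) :
    ddWord u.word (staircase (n + 2)) =
      ∑ T : u.Box, u.monomialX T * ddWord (u.deleteWord T) (staircase (n + 1)) := by
  have hw : u.word = fullWord u.i (n + 1) := rfl
  rw [hw, fullWord_succ, ddWord_append, ddWord_descWord_staircase _ _ (u.one_le _) (u.le _)]
  -- Indices are shifted by one: `q_0` is the last factor itself, already used up, so the sequence
  -- starts with `q_1` and the first critical letter is `s_{i-1}`, where `i` is the last index of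
  -- `u`.
  refine (ddWord_fullWord_prodX_mul u.one_le n (u.m (n + 1)) (u.i (n + 1) - 1)
    (fun j => u.q (n + 1) (j + 1)) (fun j => u.i (n + 1) - (j + 1)) ?_ ?_ ?_ ?_ _).trans ?_
  · intro j _
    omega
  · intro j hj
    have h := mem_M.1 (u.q_succ_mem hj)
    have h0 : u.q (n + 1) (j + 1) < u.q (n + 1) 0 := u.q_lt_q (by omega) hj
    rw [q] at h0
    have := u.one_le (u.q (n + 1) (j + 1))
    omega
  · intro i j hij hj
    exact u.q_lt_q (by omega) hj
  · rintro p j hp hpn hj hlt hgt ⟨hc1, hc2⟩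
    have := u.one_le p
    -- A skipped factor containing the critical letter would belong to the set whose maximum is
    -- `q_{j+1}`, or to the empty set if `j = m`.
    have hp : p ∈ u.M (n + 1) (j + 1) (u.q (n + 1) j) := by
      refine mem_M.2 ⟨⟨hp, ?_⟩, by omega, by omega⟩
      rcases j with _ | j
      · exact Nat.lt_succ_of_le hpn
      · exact hlt j (by omega)
    rcases u.le_q_succ hp with ⟨h1, h2⟩ | h
    · exact absurd (hgt j le_rfl h1) (by omega)
    · omega
  · refine Finset.sum_congr rfl fun T _ => ?_
    rw [monomialX, prodX, Nat.sub_right_comm]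
    rfl

theorem sum_chain (u : NormalForm (n + 2)) :
    ∑ c : Chain (n + 2) u, chainProd (n + 2) u c =
      ∑ T : u.DefBox, u.monomialX T.1 *
        ∑ c : Chain (n + 1) (u.step T), chainProd (n + 1) (u.step T) c := by
  have h := Fintype.sum_sigma (α := fun T : u.DefBox => Chain (n + 1) (u.step T))
    fun c => u.monomialX c.1.1 * chainProd (n + 1) (u.step c.1) c.2
  simp only [← Finset.mul_sum] at h
  exact h

theorem ddWord_word_staircase_eq_sum (n : ℕ) (hn : 1 ≤ n) (u : NormalForm n) :
    ddWord u.word (staircase n) = ∑ c : Chain n u, chainProd n u c := by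
  induction n, hn using Nat.le_induction with
  | base =>
    have : ∑ c : Chain 1 u, chainProd 1 u c = 1 := Fintype.sum_unique (ι := Unit) fun _ => 1
    rw [this]
    simp [word, ddWord_nil, staircase]
  | succ n hn ih =>
    obtain ⟨n, rfl⟩ : ∃ c, n = c + 1 := ⟨n - 1, by omega⟩
    classical
    rw [ddWord_word_staircase, sum_chain]
    -- The vectors for which `u(T)` is undefined contribute zero, so the sum over the box reduces to
    -- `DefBox`.
    have h0 : ∀ T : u.Box, ¬ IsReduced (n + 1) (u.deleteWord T) →
        u.monomialX T * ddWord (u.deleteWord T) (staircase (n + 1)) = 0 := fun T hT => by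
      rw [ddWord_of_not_isReduced hn (u.isWord_deleteWord T) hT, mul_zero]
    rw [← Finset.sum_filter_of_ne (p := fun T => IsReduced (n + 1) (u.deleteWord T))
      fun T _ hT => by_contra fun h => hT (h0 T h)]
    rw [← Finset.sum_subtype_eq_sum_filter, Finset.subtype_univ]
    refine Finset.sum_congr ?_ fun T _ => ?_
    · ext; simp
    · rw [← ih (u.step T), step, ← ddWord_of_isReduced hn T.2]

/-! ### Nonnegativity of coefficients -/

theorem coeff_mul_nonneg {p q : MvPolynomial ℕ ℤ} (hp : ∀ d, 0 ≤ p.coeff d)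
    (hq : ∀ d, 0 ≤ q.coeff d) (d : ℕ →₀ ℕ) : 0 ≤ (p * q).coeff d := by
  classical
  rw [coeff_mul]
  exact Finset.sum_nonneg fun x _ => mul_nonneg (hp _) (hq _)

theorem coeff_prod_X_pow_nonneg {ι : Type*} (s : Finset ι) (a e : ι → ℕ) (d : ℕ →₀ ℕ) :
    0 ≤ (∏ k ∈ s, X (a k) ^ e k : MvPolynomial ℕ ℤ).coeff d := by
  classical
  induction s using Finset.induction_on generalizing d with
  | empty =>
    rw [Finset.prod_empty, coeff_one]
    split <;> norm_num
  | insert k s hk ih =>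
    rw [Finset.prod_insert hk]
    refine coeff_mul_nonneg (fun d => ?_) ih d
    rw [coeff_X_pow]
    split <;> norm_num

theorem coeff_monomialX_nonneg (u : NormalForm n) (T : u.Box) (d : ℕ →₀ ℕ) :
    0 ≤ (u.monomialX T).coeff d := by
  refine coeff_mul_nonneg (fun d => ?_) (fun d => coeff_prod_X_pow_nonneg _ _ _ d) d
  simpa using coeff_prod_X_pow_nonneg (Finset.Icc 1 (u.i (n - 1) - u.m (n - 1) - 1)) id
    (fun _ => 1) d

theorem coeff_chainProd_nonneg (n : ℕ) (u : NormalForm n) (c : Chain n u) (d : ℕ →₀ ℕ) :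
    0 ≤ (chainProd n u c).coeff d := by
  induction n, u, c using chainProd.induct generalizing d with
  | case1 | case2 =>
    rw [chainProd, coeff_one]
    split <;> norm_num
  | case3 n u c ih => exact coeff_mul_nonneg (u.coeff_monomialX_nonneg _) ih d

end NormalForm

theorem schubert_w0 (n : ℕ) (hn : 1 ≤ n) :
    schubert n hn (perm (w0 n).word) (w0_mem n) = staircase n := by
  rw [schubert, normalForm_word_of_eq_one hn _ (inv_mul_cancel _)]
  rfl

end SchubertQ

theorem theorem2p2 :
    (∀ (n : ℕ) (hn : 2 ≤ n) (u : SchubertQ.NormalForm n),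
      SchubertQ.ddWord u.word
          (SchubertQ.schubert n (by omega) (SchubertQ.perm (SchubertQ.w0 n).word)
            (SchubertQ.w0_mem n)) =
        ∑ c : SchubertQ.NormalForm.Chain n u, SchubertQ.NormalForm.chainProd n u c) ∧
    (∀ (n : ℕ) (hn : 1 ≤ n) (w : Equiv.Perm ℕ) (hw : w ∈ SchubertQ.SymGroup n) (d : ℕ →₀ ℕ),
      0 ≤ (SchubertQ.schubert n hn w hw).coeff d) := by
  refine ⟨fun n hn u => ?_, fun n hn w hw d => ?_⟩
  · rw [SchubertQ.schubert_w0,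
      SchubertQ.NormalForm.ddWord_word_staircase_eq_sum n (by omega)]
  -- By definition the Schubert polynomial of `w` is `∂_v` of the staircase monomial with `v = [w⁻¹
  -- w_0^n]`, so the chain formula for `v` expresses it as a sum of monomials.
  · have h := SchubertQ.NormalForm.ddWord_word_staircase_eq_sum n hn
      (SchubertQ.normalForm n hn _ (mul_mem (inv_mem hw) (SchubertQ.w0_mem n)))
    refine (congrArg (MvPolynomial.coeff d) h).symm ▸ ?_
    rw [MvPolynomial.coeff_sum]
    exact Finset.sum_nonneg fun c _ => SchubertQ.NormalForm.coeff_chainProd_nonneg n _ c d
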